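/- Let $\mathcal H$ be an infinite-dimensional, separable complex Hilbert space and let $T$ be a bounded linear operator on $\mathcal H$ with property (CN): for every orthogonal projection $P$ on $\mathcal H$, $\|P T P^\perp\| = \|P^\perp T P\|$, where $P^\perp = I - P$. Then $T$ is normal, and its spectrum $\sigma(T)$ is Lavrentiev, that is, $\sigma(T)$ is a compact subset of $\mathbb C$ with empty interior and $\mathbb C \setminus \sigma(T)$ is connected. -/

import Mathlib

/-- Property (CN): for every orthogonal projection `P` (a self-adjoint idempotent in `B(H)`),
with `P⊥ = 1 - P`, the off-diagonal corners `P T P⊥` and `P⊥ T P` have the same operator norm. -/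
def HasCommonNormProperty {H : Type*} [NormedAddCommGroup H] [InnerProductSpace ℂ H]
    [CompleteSpace H] (T : H →L[ℂ] H) : Prop :=
  ∀ P : H →L[ℂ] H, IsStarProjection P → ‖P * T * (1 - P)‖ = ‖(1 - P) * T * P‖

/-- A compact subset of the plane is Lavrentiev if it has empty interior and its complement
is connected. -/
structure IsLavrentiev (Ω : Set ℂ) : Prop where
  isCompact : IsCompact Ω
  interior_eq_empty : interior Ω = ∅
  isConnected_compl : IsConnected Ωᶜ

open scoped InnerProductSpace

/-! ### Normality from rank-one projections. -/

section Normality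
variable {H : Type*} [NormedAddCommGroup H] [InnerProductSpace ℂ H]

/-! Rank-one projections in (CN) give `‖T x‖ = ‖T* x‖`, hence normality. Both spectral claims follow
from `HasCommonNormProperty.not_frontier_subset_derivedSet`: the accumulation points of the spectrum
never contain the frontier of a nonempty bounded open `G`. Interior points, or a bounded piece of
the complement, would produce such a `G`.

Suppose they did, and let `a ∈ G`. By the maximum principle and Hahn–Banach, evaluation at `a` on
polynomials extends to a state on `C(frontier G)`. In its GNS space let `A` be multiplication by
`z`. Accumulation points supply plenty of orthonormal approximate eigenvectors, so `A` is, up to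
arbitrarily small error, a part of `T`; (CN) then forces invariant subspaces of `A` to reduce it.
The closure of the polynomials vanishing at `a` is invariant and orthogonal to `1`. Were it
reducing, `z - a` would be null for the state, although `|z - a|` is bounded below on the frontier.
-/

theorem norm_mul_starProjection_span_singleton (B : H →L[ℂ] H) {x : H}
    (hx : ‖x‖ = 1) :
    ‖B * (ℂ ∙ x).starProjection‖ = ‖B x‖ := by
  apply le_antisymm
  · refine ContinuousLinearMap.opNorm_le_bound _ (norm_nonneg _) fun y => ?_
    rw [mul_apply_eq_comp, Submodule.starProjection_unit_singleton ℂ hx, map_smul,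
      norm_smul, mul_comm]
    gcongr
    simpa [hx] using norm_inner_le_norm (𝕜 := ℂ) x y
  · have h := (B * (ℂ ∙ x).starProjection).le_opNorm x
    rwa [mul_apply_eq_comp, Submodule.starProjection_eq_self_iff.mpr
      (Submodule.mem_span_singleton_self x), hx, mul_one] at h

theorem norm_sq_one_sub_starProjection_span_singleton {x : H} (hx : ‖x‖ = 1) (y : H) :
    ‖(1 - (ℂ ∙ x).starProjection : H →L[ℂ] H) y‖ ^ 2 = ‖y‖ ^ 2 - ‖⟪x, y⟫_ℂ‖ ^ 2 := by
  have h := Submodule.norm_sq_eq_add_norm_sq_starProjection y (ℂ ∙ x)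
  rw [Submodule.starProjection_orthogonal', Submodule.starProjection_unit_singleton ℂ hx y,
    norm_smul, hx, mul_one] at h
  rw [h]; simp [Submodule.starProjection_unit_singleton ℂ hx y]

theorem HasCommonNormProperty.isStarNormal [CompleteSpace H] {T : H →L[ℂ] H} (hT : HasCommonNormProperty T) :
    IsStarNormal T := by
  rw [ContinuousLinearMap.isStarNormal_iff_norm_eq_adjoint]
  have unit : ∀ x : H, ‖x‖ = 1 → ‖T x‖ = ‖T.adjoint x‖ := by
    intro x hx
    set P := (ℂ ∙ x).starProjection with hP
    have hPs : IsStarProjection P := isStarProjection_starProjection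
    have h1 := hT P hPs
    -- Taking adjoints turns (CN) into a comparison of `T` and `T*` on the same vector `x`.
    have h2 : ‖P * T * (1 - P)‖ = ‖(1 - P) * star T * P‖ := by
      rw [← norm_star]
      simp [mul_assoc, hPs.isSelfAdjoint.star_eq]
    rw [h2, norm_mul_starProjection_span_singleton _ hx,
      norm_mul_starProjection_span_singleton _ hx] at h1
    simp only [mul_apply_eq_comp] at h1
    have h3 := norm_sq_one_sub_starProjection_span_singleton hx (T x)
    have h4 := norm_sq_one_sub_starProjection_span_singleton hx (star T x)
    rw [ContinuousLinearMap.star_eq_adjoint] at h4 h1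
    rw [h1, h3, ContinuousLinearMap.adjoint_inner_right, norm_inner_symm (T x) x] at h4
    rw [← sq_eq_sq₀ (norm_nonneg _) (norm_nonneg _)]
    linarith
  intro x
  by_cases hx : x = 0
  · simp [hx]
  have h := unit ((‖x‖⁻¹ : ℂ) • x) (by simp [norm_smul, hx])
  simp only [map_smul, norm_smul] at h
  exact mul_left_cancel₀ (by simp [hx]) h

end Normality

/-! ### Orthonormal approximate eigenvectors at accumulation points of the spectrum. -/

section ApproximateEigenvectors
variable {H : Type*} [NormedAddCommGroup H] [InnerProductSpace ℂ H]

/-- If `cfc f T` has finite-dimensional range, then `f` vanishes at all but finitely many points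
of the spectrum. -/
theorem finite_spectrum_inter_support_of_finiteDimensional_range
    [CompleteSpace H] {T : H →L[ℂ] H} [IsStarNormal T]
    {f : ℂ → ℂ} (hf : Continuous f)
    [FiniteDimensional ℂ (LinearMap.range (cfc f T : H →L[ℂ] H).toLinearMap)] :
    {z ∈ spectrum ℂ T | f z ≠ 0}.Finite := by
  set R := LinearMap.range (cfc f T : H →L[ℂ] H).toLinearMap with hR
  have hcomm : T * cfc f T = cfc f T * T := by
    simpa [cfc_id' ℂ T] using (cfc_commute_cfc (fun z => z) f T).eq
  have hinv : ∀ y ∈ R, T.toLinearMap y ∈ R := by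
    rintro _ ⟨v, rfl⟩
    exact ⟨T v, (DFunLike.congr_fun hcomm v).symm⟩
  let S : R →ₗ[ℂ] R := T.toLinearMap.restrict hinv
  let q := minpoly ℂ S
  have hq0 : q ≠ 0 := minpoly.ne_zero (Algebra.IsIntegral.isIntegral S)
  have hpow : ∀ (p : Polynomial ℂ) (y : R),
      ((Polynomial.aeval S p y : R) : H) = Polynomial.aeval T p (y : H) := by
    intro p y
    induction p using Polynomial.induction_on' with
    | add p r hp hr => simp [hp, hr]
    | monomial n c =>
      have : ∀ y : R, (((S ^ n) y : R) : H) = (T ^ n) (y : H) := by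
        induction n with
        | zero => intro y; simp
        | succ n ih =>
          intro y
          rw [pow_succ, pow_succ, Module.End.mul_apply, ih]
          rfl
      simp [Polynomial.aeval_monomial, this, Algebra.algebraMap_eq_smul_one]
  -- The minimal polynomial of `T` on the range of `f(T)` annihilates that range, so `q f = 0` on
  -- the spectrum.
  have hzero : cfc (fun z => q.eval z * f z) T = cfc (fun _ => (0 : ℂ)) T := by
    rw [cfc_mul (fun z => q.eval z) f T q.continuous.continuousOn hf.continuousOn,
      cfc_polynomial q T, cfc_const_zero]
    ext v
    have := hpow q ⟨cfc f T v, v, rfl⟩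
    rw [minpoly.aeval] at this
    simpa using this.symm
  have heq := eqOn_of_cfc_eq_cfc hzero (q.continuous.mul hf).continuousOn continuousOn_const
  refine (q.roots.toFinset.finite_toSet).subset ?_
  rintro z ⟨hz, hfz⟩
  have := heq hz
  simp only [mul_eq_zero, hfz, or_false] at this
  simpa [hq0] using this

/-- A bump `f` at `μ` is nonzero at infinitely many spectral points, so the range of `f(T)` is
infinite-dimensional and meets `Fᗮ`. A wider bump `g` with `g f = f` makes `T - μ` act on that range
as `((z - μ) g)(T)`, of norm at most `ε`. -/
theorem exists_norm_apply_sub_smul_le_of_accPt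
    [CompleteSpace H] {T : H →L[ℂ] H} [IsStarNormal T] {μ : ℂ}
    (hμ : μ ∈ derivedSet (spectrum ℂ T)) (F : Submodule ℂ H) [FiniteDimensional ℂ F] {ε : ℝ}
    (hε : 0 < ε) : ∃ x : H, ‖x‖ = 1 ∧ x ∈ Fᗮ ∧ ‖T x - μ • x‖ ≤ ε := by
  let f : ℂ → ℂ := fun z => ((max 0 (ε / 2 - ‖z - μ‖) : ℝ) : ℂ)
  let g : ℂ → ℂ := fun z => ((min 1 (max 0 (2 - 2 * ‖z - μ‖ / ε)) : ℝ) : ℂ)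
  have hf : Continuous f := by fun_prop
  have hg : Continuous g := by fun_prop
  have hgf : ∀ z, g z * f z = f z := by
    intro z
    rcases le_total ‖z - μ‖ (ε / 2) with h | h
    · have : g z = 1 := by
        have h2 : 2 * ‖z - μ‖ / ε ≤ 1 := by rw [div_le_one hε]; linarith
        simp only [g]
        rw [min_eq_left (le_max_of_le_right (by linarith))]; simp
      rw [this, one_mul]
    · have : f z = 0 := by
        simp only [f]; rw [max_eq_left (by linarith)]; simp
      rw [this, mul_zero]
  have hgn : ∀ z, ‖(z - μ) * g z‖ ≤ ε := by
    intro z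
    rw [norm_mul, Complex.norm_real, Real.norm_of_nonneg (by positivity)]
    rcases le_total ‖z - μ‖ ε with h | h
    · calc _ ≤ ‖z - μ‖ * 1 := by gcongr; exact min_le_left _ _
        _ ≤ ε := by simpa using h
    · have : 2 - 2 * ‖z - μ‖ / ε ≤ 0 := by
        rw [sub_nonpos, le_div_iff₀ hε]; linarith
      rw [max_eq_left this]; simp [hε.le]
  set R := LinearMap.range (cfc f T : H →L[ℂ] H).toLinearMap with hR
  have hRinf : ¬ FiniteDimensional ℂ R := by
    intro _
    refine Set.Infinite.of_accPt (S := {z ∈ spectrum ℂ T | f z ≠ 0}) (x := μ) ?_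
      (finite_spectrum_inter_support_of_finiteDimensional_range hf)
    rw [accPt_iff_nhds]
    intro U hU
    obtain ⟨y, ⟨⟨hyU, hyB⟩, hyS⟩, hy⟩ :=
      accPt_iff_nhds.mp hμ (U ∩ Metric.ball μ (ε / 2)) (Filter.inter_mem hU
        (Metric.ball_mem_nhds _ (by positivity)))
    refine ⟨y, ⟨hyU, hyS, ?_⟩, hy⟩
    rw [Metric.mem_ball, dist_eq_norm] at hyB
    have : 0 < max 0 (ε / 2 - ‖y - μ‖) := lt_max_of_lt_right (by linarith)
    simpa [f] using this.ne'
  have hex : ∃ y : R, y ≠ 0 ∧ F.orthogonalProjectionOnto (y : H) = 0 := by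
    by_contra! hcon
    refine hRinf (FiniteDimensional.of_injective
      (F.orthogonalProjectionOnto.toLinearMap ∘ₗ R.subtype) ?_)
    rw [← LinearMap.ker_eq_bot, LinearMap.ker_eq_bot']
    intro y hy
    by_contra hy0
    exact hcon y hy0 hy
  obtain ⟨⟨y, v, hv⟩, hy0, hyF⟩ := hex
  have hy0 : y ≠ 0 := fun h => hy0 (by ext; exact h)
  have hbound : ‖T y - μ • y‖ ≤ ε * ‖y‖ := by
    have h1 : (T - algebraMap ℂ (H →L[ℂ] H) μ) * cfc f T
        = cfc (fun z => (z - μ) * g z) T * cfc f T := by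
      rw [← cfc_mul _ _ T, ← cfc_id' ℂ T, ← cfc_const μ T, cfc_id' ℂ T]
      nth_rewrite 1 [← cfc_id' ℂ T]
      rw [← cfc_sub _ _ T, ← cfc_mul _ _ T]
      congr 1
      ext z
      rw [mul_assoc, hgf]
    have h2 := DFunLike.congr_fun h1 v
    have h3 : T y - μ • y = cfc (fun z => (z - μ) * g z) T y := by
      rw [← hv]
      simpa [Algebra.algebraMap_eq_smul_one] using h2
    rw [h3]
    exact (ContinuousLinearMap.le_opNorm _ _).trans
      (by gcongr; exact norm_cfc_le hε.le fun z _ => hgn z)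
  have hny : 0 < ‖y‖ := norm_pos_iff.mpr hy0
  refine ⟨(‖y‖⁻¹ : ℂ) • y, by simp [norm_smul, hy0], ?_, ?_⟩
  · exact Submodule.smul_mem _ _ (Submodule.orthogonalProjectionOnto_eq_zero_iff.mp hyF)
  · rw [map_smul, smul_comm, ← smul_sub, norm_smul]
    simp only [norm_inv, Complex.norm_real, norm_norm]
    rw [inv_mul_le_iff₀ hny]; linarith

theorem exists_orthonormal_seq_of_forall_finiteDimensional {Q : ℕ → H → Prop}
    (hQ : ∀ (n : ℕ) (F : Submodule ℂ H), FiniteDimensional ℂ F →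
      ∃ x : H, ‖x‖ = 1 ∧ x ∈ Fᗮ ∧ Q n x) :
    ∃ x : ℕ → H, Orthonormal ℂ x ∧ ∀ n, Q n (x n) := by
  classical
  choose f hf1 hfo hfQ using fun (n : ℕ) (s : Finset H) =>
    hQ n (Submodule.span ℂ (s : Set H)) (FiniteDimensional.span_finset ℂ s)
  let L : ℕ → Finset H := fun n => Nat.rec ∅ (fun n s => insert (f n s) s) n
  have hL : ∀ n, L (n + 1) = insert (f n (L n)) (L n) := fun _ => rfl
  have hmem : ∀ m n, m < n → f m (L m) ∈ L n := by
    intro m n hmn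
    induction n with
    | zero => omega
    | succ n ih =>
      rw [hL, Finset.mem_insert]
      rcases Nat.lt_succ_iff_lt_or_eq.mp hmn with h | h
      · exact Or.inr (ih h)
      · exact Or.inl (by rw [h])
  have hlt : ∀ m n, m < n → ⟪f m (L m), f n (L n)⟫_ℂ = 0 := fun m n hmn =>
    hfo n (L n) _ (Submodule.subset_span (hmem m n hmn))
  refine ⟨fun n => f n (L n), ⟨fun n => hf1 _ _, fun m n hmn => ?_⟩, fun n => hfQ _ _⟩
  rcases lt_or_gt_of_ne hmn with h | h
  · exact hlt m n h
  · exact inner_eq_zero_symm.mp (hlt n m h)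

theorem exists_orthonormal_norm_apply_sub_smul_le
    [CompleteSpace H] {T : H →L[ℂ] H} [IsStarNormal T] {ι : Type*}
    [Countable ι] {μ : ι → ℂ} (hμ : ∀ i, μ i ∈ derivedSet (spectrum ℂ T)) {ε : ι → ℝ}
    (hε : ∀ i, 0 < ε i) :
    ∃ x : ι → H, Orthonormal ℂ x ∧ ∀ i, ‖T (x i) - μ i • x i‖ ≤ ε i := by
  rcases isEmpty_or_nonempty ι with _ | _
  · exact ⟨isEmptyElim, ⟨isEmptyElim, fun i => isEmptyElim i⟩, isEmptyElim⟩
  obtain ⟨e, he⟩ := exists_injective_nat ι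
  let g := Function.invFun e
  have hg : ∀ i, g (e i) = i := Function.leftInverse_invFun he
  obtain ⟨x, hx, hxQ⟩ := exists_orthonormal_seq_of_forall_finiteDimensional
    (Q := fun n x => ‖T x - μ (g n) • x‖ ≤ ε (g n))
    fun n F _ => exists_norm_apply_sub_smul_le_of_accPt (hμ (g n)) F (hε (g n))
  refine ⟨x ∘ e, hx.comp e he, fun i => ?_⟩
  simpa [hg] using hxQ (e i)

end ApproximateEigenvectors

/-! ### Approximate parts of `T` and the transfer of (CN) to them. -/

section Transplantation
variable {H K : Type*} [NormedAddCommGroup H] [InnerProductSpace ℂ H]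
  [NormedAddCommGroup K] [InnerProductSpace ℂ K]

theorem Orthonormal.countable_of_separableSpace [TopologicalSpace.SeparableSpace K] {ι : Type*}
    {v : ι → K} (hv : Orthonormal ℂ v) : Countable ι := by
  have hdist : ∀ i j, i ≠ j → 1 ≤ dist (v i) (v j) := by
    intro i j hij
    have h := norm_sub_sq (𝕜 := ℂ) (v i) (v j)
    rw [hv.1 i, hv.1 j, hv.2 hij] at h
    rw [dist_eq_norm]
    simp only [map_zero] at h
    nlinarith [norm_nonneg (v i - v j)]
  refine Pairwise.countable_of_isOpen_disjoint (s := fun i => Metric.ball (v i) (1 / 2))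
    (fun i j hij => Metric.ball_disjoint_ball (by linarith [hdist i j hij]))
    (fun _ => Metric.isOpen_ball) fun i => ⟨v i, Metric.mem_ball_self (by norm_num)⟩

/-- Each `R i` carries a countable Hilbert basis of `K` to its own block of one orthonormal family
of approximate eigenvectors; errors summable over the basis add up to at most `δ`. -/
theorem exists_isometries_orthogonal_ranges_norm_comp_sub_smul_le [CompleteSpace H]
    [CompleteSpace K] [TopologicalSpace.SeparableSpace K] {T : H →L[ℂ] H} [IsStarNormal T]
    {ι : Type*} [Finite ι] {μ : ι → ℂ} (hμ : ∀ i, μ i ∈ derivedSet (spectrum ℂ T)) {δ : ℝ}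
    (hδ : 0 < δ) :
    ∃ R : ι → K →ₗᵢ[ℂ] H, (∀ i j, i ≠ j → ∀ g h, ⟪R i g, R j h⟫_ℂ = 0) ∧
      ∀ i g, ‖T (R i g) - μ i • R i g‖ ≤ δ * ‖g‖ := by
  obtain ⟨w, b, hb⟩ := exists_hilbertBasis ℂ K
  have : Countable w := b.orthonormal.countable_of_separableSpace
  let _ : Encodable w := Encodable.ofCountable w
  obtain ⟨ε, hε, c, hεc, hcδ⟩ := posSumOfEncodable hδ w
  obtain ⟨x, hx, hxT⟩ := exists_orthonormal_norm_apply_sub_smul_le (T := T) (ι := ι × w)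
    (μ := fun p => μ p.1) (fun p => hμ p.1) (ε := fun p => ε p.2) (fun p => hε p.2)
  have hxi : ∀ i, Orthonormal ℂ fun k : w => x (i, k) := fun i =>
    hx.comp _ (fun _ _ h => (Prod.mk.inj h).2)
  let R : ι → K →ₗᵢ[ℂ] H := fun i =>
    (hxi i).orthogonalFamily.linearIsometry.comp b.repr.toLinearIsometry
  have hsum : ∀ i g, HasSum (fun k => b.repr g k • x (i, k)) (R i g) := by
    intro i g
    simpa [R] using (hxi i).orthogonalFamily.hasSum_linearIsometry (b.repr g)
  have hcoef : ∀ g k, ‖b.repr g k‖ ≤ ‖g‖ := fun g k => by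
    simpa using lp.norm_apply_le_norm (by simp) (b.repr g) k
  refine ⟨R, fun i j hij g h => ?_, fun i g => ?_⟩
  · have h1 : ∀ k, ⟪x (i, k), R j h⟫_ℂ = 0 := fun k => by
      refine ((hsum j h).mapL (innerSL ℂ (x (i, k)))).unique ?_
      convert hasSum_zero using 2 with l
      simp [hx.2 (show (i, k) ≠ (j, l) by simp [hij])]
    rw [← inner_conj_symm]
    have h2 : ⟪R j h, R i g⟫_ℂ = 0 := by
      refine ((hsum i g).mapL (innerSL ℂ (R j h))).unique ?_
      convert hasSum_zero using 2 with l
      simp [inner_eq_zero_symm.mp (h1 l)]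
    simp [h2]
  · have h1 := (hsum i g).mapL (T - μ i • ContinuousLinearMap.id ℂ H)
    have h2 : ‖(T - μ i • ContinuousLinearMap.id ℂ H) (R i g)‖ ≤ ‖g‖ * c := by
      rw [← h1.tsum_eq]
      refine tsum_of_norm_bounded (hεc.mul_left ‖g‖) fun k => ?_
      rw [map_smul, norm_smul]
      gcongr
      · exact hcoef g k
      · simpa using hxT (i, k)
    calc _ ≤ ‖g‖ * c := by simpa using h2
      _ ≤ δ * ‖g‖ := by rw [mul_comm]; gcongr

variable {X : Type*} [TopologicalSpace X]

theorem norm_sq_sum_isometry_comp_representation [CompleteSpace K] {ι : Type*} [Fintype ι] {R : ι → K →ₗᵢ[ℂ] H}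
    (hR : ∀ i j, i ≠ j → ∀ g h, ⟪R i g, R j h⟫_ℂ = 0) (π : C(X, ℂ) →⋆ₐ[ℂ] (K →L[ℂ] K))
    (v : ι → C(X, ℂ)) (g : K) :
    ((‖∑ i, R i (π (v i) g)‖ ^ 2 : ℝ) : ℂ) = ⟪g, π (∑ i, star (v i) * v i) g⟫_ℂ := by
  have h := inner_self_eq_norm_sq_to_K (𝕜 := ℂ) (∑ i, R i (π (v i) g))
  push_cast
  simp only [Complex.coe_algebraMap] at h
  rw [← h, sum_inner, map_sum, sum_apply, inner_sum]
  refine Finset.sum_congr rfl fun i _ => ?_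
  rw [inner_sum, Finset.sum_eq_single i (fun j _ hj => hR i j hj.symm _ _) (by simp),
    LinearIsometry.inner_map_map, map_mul, map_star, mul_apply_eq_comp,
    ContinuousLinearMap.star_eq_adjoint, ContinuousLinearMap.adjoint_inner_right]

/-- If the weights `u i` are a quadratic partition of unity and `u i` lives where `z` is close
to `μ i`, then `π z` is approximately unitarily equivalent to a part of `T`. -/
theorem exists_isometry_norm_comp_sub_comp_le [CompactSpace X] [CompleteSpace H]
    [CompleteSpace K] [TopologicalSpace.SeparableSpace K] {T : H →L[ℂ] H}
    [IsStarNormal T] {ι : Type*} [Fintype ι] {μ : ι → ℂ}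
    (hμ : ∀ i, μ i ∈ derivedSet (spectrum ℂ T)) (π : C(X, ℂ) →⋆ₐ[ℂ] (K →L[ℂ] K))
    {u : ι → C(X, ℂ)} (hu : ∑ i, star (u i) * u i = 1) {z : C(X, ℂ)} {ε : ℝ} (hε : 0 < ε)
    (huz : ∀ i t, u i t ≠ 0 → ‖μ i - z t‖ ≤ ε) :
    ∃ W : K →ₗᵢ[ℂ] H, ∀ g, ‖T (W g) - W (π z g)‖ ≤ 2 * ε * ‖g‖ := by
  have hone : ∀ t, ∑ i, ‖u i t‖ ^ 2 = (1 : ℝ) := by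
    intro t
    have h := DFunLike.congr_fun hu t
    have h2 : ((∑ i, ‖u i t‖ ^ 2 : ℝ) : ℂ) = (1 : ℝ) := by
      push_cast
      simp only [ContinuousMap.coe_sum, Finset.sum_apply, ContinuousMap.mul_apply,
        ContinuousMap.star_apply, ContinuousMap.one_apply, Complex.star_def,
        Complex.conj_mul'] at h
      exact h
    exact_mod_cast h2
  -- The `+ 1` keeps the divisor positive when `ι` is empty.
  let n : ℝ := Fintype.card ι + 1
  have hn : 0 < n := by positivity
  obtain ⟨R, hR, hRT⟩ := exists_isometries_orthogonal_ranges_norm_comp_sub_smul_le (K := K) hμ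
    (div_pos hε hn)
  let W₀ : K →ₗ[ℂ] H := ∑ i, (R i).toLinearMap ∘ₗ (π (u i)).toLinearMap
  have hW₀ : ∀ g, W₀ g = ∑ i, R i (π (u i) g) := fun g => by simp [W₀]
  have hiso : ∀ g, ‖W₀ g‖ = ‖g‖ := by
    intro g
    have h := norm_sq_sum_isometry_comp_representation hR π u g
    rw [hu, map_one, one_apply_eq_self, inner_self_eq_norm_sq_to_K, ← hW₀] at h
    rw [← sq_eq_sq₀ (norm_nonneg _) (norm_nonneg _)]
    simp only [Complex.coe_algebraMap] at h
    exact_mod_cast h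
  refine ⟨⟨W₀, hiso⟩, fun g => ?_⟩
  change ‖T (W₀ g) - W₀ (π z g)‖ ≤ _
  -- The error splits in two: `R i` maps only to approximate eigenvectors, and `z` is replaced by `μ
  -- i` where `u i` lives. The weights `v i` measure the second part.
  let v : ι → C(X, ℂ) := fun i => u i * (algebraMap ℂ _ (μ i) - z)
  have hdecomp : T (W₀ g) - W₀ (π z g) =
      ∑ i, (T (R i (π (u i) g)) - μ i • R i (π (u i) g)) + ∑ i, R i (π (v i) g) := by
    rw [hW₀, hW₀, map_sum, ← Finset.sum_add_distrib, ← Finset.sum_sub_distrib]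
    refine Finset.sum_congr rfl fun i _ => ?_
    have : π (v i) g = μ i • π (u i) g - π (u i) (π z g) := by
      simp [v, Algebra.algebraMap_eq_smul_one, mul_sub]
    rw [this, map_sub, map_smul]
    abel
  have hfirst : ‖∑ i, (T (R i (π (u i) g)) - μ i • R i (π (u i) g))‖ ≤ ε * ‖g‖ := by
    have hui : ∀ i, ‖π (u i) g‖ ≤ ‖g‖ := by
      intro i
      refine (ContinuousLinearMap.le_of_opNorm_le _ ((NonUnitalStarAlgHom.norm_apply_le π (u i)).trans
        ((ContinuousMap.norm_le _ zero_le_one).mpr fun t => ?_)) g).trans_eq (one_mul _)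
      rw [← sq_le_one_iff₀ (norm_nonneg _), ← hone t]
      exact Finset.single_le_sum (f := fun i => ‖u i t‖ ^ 2) (fun _ _ => by positivity)
        (Finset.mem_univ i)
    calc _ ≤ ∑ i : ι, ε / n * ‖g‖ := norm_sum_le_of_le _ fun i _ =>
          (hRT i _).trans (by gcongr; exact hui i)
      _ = (Fintype.card ι / n) * (ε * ‖g‖) := by simp; ring
      _ ≤ 1 * (ε * ‖g‖) := by
          gcongr
          rw [div_le_one hn]; simp [n]
      _ = _ := one_mul _
  have hsecond : ‖∑ i, R i (π (v i) g)‖ ≤ ε * ‖g‖ := by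
    have h := norm_sq_sum_isometry_comp_representation hR π v g
    have hv : ‖∑ i, star (v i) * v i‖ ≤ ε ^ 2 := by
      refine (ContinuousMap.norm_le _ (by positivity)).mpr fun t => ?_
      calc ‖(∑ i, star (v i) * v i) t‖ ≤ ∑ i, ‖u i t‖ ^ 2 * ε ^ 2 := by
            simp only [ContinuousMap.coe_sum, Finset.sum_apply]
            refine norm_sum_le_of_le _ fun i _ => ?_
            simp only [ContinuousMap.mul_apply, ContinuousMap.star_apply, norm_mul, norm_star, v,
              ContinuousMap.sub_apply, algebraMap_apply, smul_eq_mul, mul_one]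
            rw [← sq, mul_pow]
            by_cases h0 : u i t = 0
            · simp [h0]
            · gcongr
              simpa using huz i t h0
        _ = ε ^ 2 := by rw [← Finset.sum_mul, hone, one_mul]
    rw [← sq_le_sq₀ (norm_nonneg _) (by positivity)]
    calc ‖∑ i, R i (π (v i) g)‖ ^ 2 = ‖((‖∑ i, R i (π (v i) g)‖ ^ 2 : ℝ) : ℂ)‖ := by
          rw [Complex.norm_real, Real.norm_of_nonneg (by positivity)]
      _ = ‖⟪g, π (∑ i, star (v i) * v i) g⟫_ℂ‖ := by rw [h]
      _ ≤ ‖g‖ * (ε ^ 2 * ‖g‖) := (norm_inner_le_norm _ _).trans (by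
          gcongr
          exact ContinuousLinearMap.le_of_opNorm_le _
            ((NonUnitalStarAlgHom.norm_apply_le π _).trans hv) g)
      _ = (ε * ‖g‖) ^ 2 := by ring
  rw [hdecomp]
  calc _ ≤ ε * ‖g‖ + ε * ‖g‖ := norm_add_le_of_le hfirst hsecond
    _ = _ := by ring

/-- Property (CN) passes to operators that are approximate parts of `T`, in the form that
invariant subspaces of such operators are reducing. -/
theorem HasCommonNormProperty.mul_mul_one_sub_eq_zero_of_approximate_part
    [CompleteSpace H] [CompleteSpace K] {T : H →L[ℂ] H}
    (hT : HasCommonNormProperty T) {A : K →L[ℂ] K}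
    (hA : ∀ ε : ℝ, 0 < ε → ∃ W : K →ₗᵢ[ℂ] H, ∀ g, ‖T (W g) - W (A g)‖ ≤ ε * ‖g‖)
    {P : K →L[ℂ] K} (hP : IsStarProjection P) (hPA : (1 - P) * A * P = 0) :
    P * A * (1 - P) = 0 := by
  rw [← norm_le_zero_iff]
  refine le_of_forall_pos_le_add fun ε hε => ?_
  obtain ⟨W', hW'⟩ := hA (ε / 2) (half_pos hε)
  let W : K →L[ℂ] H := W'.toContinuousLinearMap
  have hWn : ‖W‖ ≤ 1 := W'.norm_toContinuousLinearMap_le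
  have hWn' : ‖W.adjoint‖ ≤ 1 := by rwa [LinearIsometryEquiv.norm_map]
  have hWW : ∀ g, W.adjoint (W g) = g := fun g => by
    refine ext_inner_left ℂ fun h => ?_
    rw [ContinuousLinearMap.adjoint_inner_right]
    exact W'.inner_map_map h g
  -- (CN) is applied to the transplanted projection: one corner of `T` is small because `A` leaves
  -- the range of `P` invariant, hence so is the other, which compresses back to `P A (1 - P)`.
  let Q : H →L[ℂ] H := W ∘L P ∘L W.adjoint
  have hPP : ∀ g, P (P g) = P g := fun g => DFunLike.congr_fun hP.isIdempotentElem g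
  have hPn : ‖P‖ ≤ 1 := hP.norm_le
  have hPn' : ‖1 - P‖ ≤ 1 := hP.one_sub.norm_le
  have hQ : IsStarProjection Q := by
    refine ⟨?_, ?_⟩
    · ext h
      simp [Q, hWW, hPP]
    · have : P.adjoint = P := hP.isSelfAdjoint
      rw [IsSelfAdjoint, ContinuousLinearMap.star_eq_adjoint]
      simp [Q, ContinuousLinearMap.adjoint_comp, this, ContinuousLinearMap.comp_assoc]
  have hright : ‖(1 - Q) * T * Q‖ ≤ ε / 2 := by
    refine ContinuousLinearMap.opNorm_le_bound _ (by positivity) fun h => ?_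
    set g := P (W.adjoint h) with hg
    have hgn : ‖g‖ ≤ ‖h‖ := by
      calc ‖g‖ ≤ 1 * (1 * ‖h‖) := (P.le_of_opNorm_le hPn _).trans (by
            gcongr; exact ContinuousLinearMap.le_of_opNorm_le _ hWn' _)
        _ = ‖h‖ := by ring
    have hzero : (1 - Q) (W (A g)) = 0 := by
      have := DFunLike.congr_fun hPA (W.adjoint h)
      simp only [mul_apply_eq_comp, sub_apply,
        one_apply_eq_self, zero_apply, ← hg] at this
      simp only [Q, sub_apply, one_apply_eq_self,
        ContinuousLinearMap.comp_apply, hWW, ← map_sub, this, map_zero]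
    calc ‖((1 - Q) * T * Q) h‖ = ‖(1 - Q) (T (W g) - W (A g))‖ := by
          rw [map_sub, hzero, sub_zero]; rfl
      _ ≤ 1 * (ε / 2 * ‖g‖) := (ContinuousLinearMap.le_of_opNorm_le _ hQ.one_sub.norm_le _).trans
          (by gcongr; exact hW' g)
      _ ≤ ε / 2 * ‖h‖ := by rw [one_mul]; gcongr
  rw [← hT Q hQ] at hright
  rw [zero_add]
  refine ContinuousLinearMap.opNorm_le_bound _ hε.le fun g => ?_
  set k := (1 - P) g with hk
  have hkn : ‖k‖ ≤ ‖g‖ := ((1 - P).le_of_opNorm_le hPn' g).trans_eq (one_mul _)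
  have hQk : (1 - Q) (W g) = W k := by
    simp [Q, hWW, hk]
  have hmain : (P * A * (1 - P)) g =
      W.adjoint ((Q * T * (1 - Q)) (W g)) - P (W.adjoint (T (W k) - W (A k))) := by
    simp only [mul_apply_eq_comp, hQk]
    simp [Q, hWW, hk]
  rw [hmain]
  have e1 : ‖W.adjoint ((Q * T * (1 - Q)) (W g))‖ ≤ 1 * (ε / 2 * ‖g‖) :=
    (ContinuousLinearMap.le_of_opNorm_le _ hWn' _).trans (by
      gcongr
      refine (ContinuousLinearMap.le_of_opNorm_le _ hright _).trans_eq ?_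
      rw [show ‖W g‖ = ‖g‖ from W'.norm_map g])
  have e2 : ‖P (W.adjoint (T (W k) - W (A k)))‖ ≤ 1 * (1 * (ε / 2 * ‖g‖)) :=
    (P.le_of_opNorm_le hPn _).trans (by
      gcongr
      refine (ContinuousLinearMap.le_of_opNorm_le _ hWn' _).trans ?_
      gcongr
      exact (hW' k).trans (by gcongr))
  calc _ ≤ 1 * (ε / 2 * ‖g‖) + 1 * (1 * (ε / 2 * ‖g‖)) := norm_sub_le_of_le e1 e2
    _ = ε * ‖g‖ := by ring

end Transplantation

/-! ### Point evaluation as a boundary state, and the GNS contradiction. -/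

section States
open scoped ComplexOrder

variable {X : Type*} [TopologicalSpace X] [CompactSpace X]

theorem ContinuousMap.exists_quadratic_partition_of_unity (z : C(X, ℂ)) {ε : ℝ} (hε : 0 < ε) :
    ∃ (t : Finset X) (u : t → C(X, ℂ)), ∑ i, star (u i) * u i = 1 ∧
      ∀ i s, u i s ≠ 0 → ‖z i - z s‖ ≤ ε := by
  obtain ⟨t, ht⟩ := CompactSpace.elim_nhds_subcover (fun x => {s | ‖z x - z s‖ < ε}) fun x =>
    (isOpen_lt (by fun_prop) continuous_const).mem_nhds (by simpa using hε)
  let h : t → X → ℝ := fun i s => max 0 (ε - ‖z i - z s‖)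
  have hcont : ∀ i, Continuous (h i) := fun i => by fun_prop
  have hpos : ∀ s, 0 < ∑ i, h i s ^ 2 := by
    intro s
    have hs : s ∈ ⋃ x ∈ t, {s | ‖z x - z s‖ < ε} := ht ▸ Set.mem_univ s
    simp only [Set.mem_iUnion, Set.mem_ofPred_eq] at hs
    obtain ⟨x, hx, hxs⟩ := hs
    refine Finset.sum_pos' (fun _ _ => sq_nonneg _) ⟨⟨x, hx⟩, Finset.mem_univ _, ?_⟩
    have : 0 < h ⟨x, hx⟩ s := lt_max_of_lt_right (by simpa using hxs)
    positivity
  have hsqrt : ∀ s, √(∑ i, h i s ^ 2) ≠ 0 := fun s => (Real.sqrt_pos.mpr (hpos s)).ne'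
  let u : t → C(X, ℂ) := fun i =>
    { toFun := fun s => ((h i s / √(∑ j, h j s ^ 2) : ℝ) : ℂ)
      continuous_toFun := Complex.continuous_ofReal.comp
        ((hcont i).div (by fun_prop) hsqrt) }
  refine ⟨t, u, ?_, fun i s his => ?_⟩
  · ext s
    simp only [ContinuousMap.coe_sum, Finset.sum_apply, ContinuousMap.mul_apply,
      ContinuousMap.star_apply, ContinuousMap.one_apply, u, ContinuousMap.coe_mk,
      Complex.star_def, Complex.conj_ofReal]
    norm_cast
    rw [← div_self (hpos s).ne', Finset.sum_div]
    refine Finset.sum_congr rfl fun i _ => ?_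
    rw [← sq, div_pow, Real.sq_sqrt (hpos s).le]
  · by_contra! hlt
    refine his ?_
    have : h i s = 0 := max_eq_left (by linarith)
    simp [u, this]

/-- A contraction fixing `1` sends `f` into every closed disc containing the values of `f`. Discs
centred far up or down the imaginary axis force `φ f` to be real; the disc centred at `‖f‖` with
radius `‖f‖` forces its real part to be nonnegative. -/
theorem ContinuousLinearMap.nonneg_of_norm_le_one_of_map_one {φ : C(X, ℂ) →L[ℂ] ℂ}
    (hφ : ‖φ‖ ≤ 1) (h1 : φ 1 = 1) {f : C(X, ℂ)} (hf : 0 ≤ f) : 0 ≤ φ f := by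
  have hfs : ∀ s, 0 ≤ (f s).re ∧ (f s).im = 0 ∧ (f s).re ≤ ‖f‖ := fun s => by
    have h := Complex.nonneg_iff.mp (ContinuousMap.le_def.mp hf s)
    exact ⟨h.1, h.2.symm, (Complex.re_le_norm _).trans (f.norm_coe_le_norm s)⟩
  have hbound : ∀ (c : ℂ) (r : ℝ), 0 ≤ r → (∀ s, ‖f s - c‖ ≤ r) → ‖φ f - c‖ ≤ r := by
    intro c r hr hc
    have h := φ.le_of_opNorm_le hφ (f - c • 1)
    rw [map_sub, map_smul, h1, one_mul, smul_eq_mul, mul_one] at h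
    exact h.trans ((ContinuousMap.norm_le _ hr).mpr fun s => by simpa using hc s)
  have him : ∀ t : ℝ, (φ f).re ^ 2 + ((φ f).im - t) ^ 2 ≤ ‖f‖ ^ 2 + t ^ 2 := by
    intro t
    have h := hbound (t * Complex.I) √(‖f‖ ^ 2 + t ^ 2) (Real.sqrt_nonneg _) fun s => by
      obtain ⟨h1, h2, h3⟩ := hfs s
      rw [Complex.norm_eq_sqrt_sq_add_sq]
      refine Real.sqrt_le_sqrt ?_
      simp [h2]
      nlinarith
    rw [Complex.norm_eq_sqrt_sq_add_sq] at h
    have := (Real.sqrt_le_sqrt_iff (by positivity)).mp h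
    simpa using this
  refine Complex.nonneg_iff.mpr ⟨?_, ?_⟩
  · have h := hbound ‖f‖ ‖f‖ (norm_nonneg _) fun s => by
      obtain ⟨h1, h2, h3⟩ := hfs s
      rw [show f s = ((f s).re : ℂ) from Complex.ext rfl (by simp [h2]), ← Complex.ofReal_sub,
        Complex.norm_real, Real.norm_eq_abs, abs_le]
      constructor <;> linarith
    have := (Complex.abs_re_le_norm _).trans h
    rw [abs_le] at this
    simp only [Complex.sub_re, Complex.ofReal_re] at this
    linarith
  · by_contra hne
    have hne : (φ f).im ≠ 0 := fun h => hne h.symm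
    have h := him (-(‖f‖ ^ 2 + 1) / (2 * (φ f).im))
    have e : (φ f).im * (-(‖f‖ ^ 2 + 1) / (2 * (φ f).im)) = -(‖f‖ ^ 2 + 1) / 2 := by
      field_simp
    nlinarith [sq_nonneg (φ f).re, sq_nonneg (φ f).im]

/-- Evaluation at a point of a bounded set is represented by a state on the boundary. -/
theorem exists_state_frontier_eval {G : Set ℂ} (hG : Bornology.IsBounded G) {a : ℂ} (ha : a ∈ G)
    [CompactSpace (frontier G)] :
    ∃ f : C(frontier G, ℂ) →ₚ[ℂ] ℂ, ∀ p : Polynomial ℂ,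
      f (Polynomial.toContinuousMapOnAlgHom (frontier G) p) = p.eval a := by
  let Φ : Polynomial ℂ →ₗ[ℂ] C(frontier G, ℂ) :=
    (Polynomial.toContinuousMapOnAlgHom (frontier G)).toLinearMap
  let ψ : Polynomial ℂ →ₗ[ℂ] ℂ := Polynomial.leval a
  have hmax : ∀ p, ‖ψ p‖ ≤ ‖Φ p‖ := fun p =>
    Complex.norm_le_of_forall_mem_frontier_norm_le hG p.differentiable.diffContOnCl
      (fun z hz => (Φ p).norm_coe_le_norm ⟨z, hz⟩) (subset_closure ha)
  -- The maximum principle makes evaluation at `a` vanish on the kernel of restriction, so it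
  -- descends to functions on the frontier.
  have hψ : ψ ∈ LinearMap.range Φ.dualMap := by
    rw [LinearMap.range_dualMap_eq_dualAnnihilator_ker, Submodule.mem_dualAnnihilator]
    intro p hp
    have := hmax p
    rwa [LinearMap.mem_ker.mp hp, norm_zero, norm_le_zero_iff] at this
  obtain ⟨χ, hχ⟩ := hψ
  have hχΦ : ∀ p, χ (Φ p) = ψ p := fun p => LinearMap.congr_fun hχ p
  let χ₀ : StrongDual ℂ (LinearMap.range Φ) :=
    (χ ∘ₗ (LinearMap.range Φ).subtype).mkContinuous 1 (by
      rintro ⟨_, p, rfl⟩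
      rw [one_mul]
      change ‖χ (Φ p)‖ ≤ ‖Φ p‖
      rw [hχΦ]
      exact hmax p)
  obtain ⟨φ, hφ, hφn⟩ := exists_extension_norm_eq _ χ₀
  have hφΦ : ∀ p, φ (Φ p) = p.eval a := fun p => (hφ ⟨Φ p, p, rfl⟩).trans (hχΦ p)
  have hn : ‖φ‖ ≤ 1 := hφn ▸ LinearMap.mkContinuous_norm_le _ zero_le_one _
  have h1 : φ 1 = 1 := by
    have h := hφΦ 1
    rwa [show Φ 1 = 1 from map_one (Polynomial.toContinuousMapOnAlgHom (frontier G)),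
      Polynomial.eval_one] at h
  exact ⟨PositiveLinearMap.mk₀ φ.toLinearMap fun f hf =>
    ContinuousLinearMap.nonneg_of_norm_le_one_of_map_one hn h1 hf, hφΦ⟩

variable {H : Type*} [NormedAddCommGroup H] [InnerProductSpace ℂ H] [CompleteSpace H]

/-- Separability gives the GNS space the countable basis needed for summable errors. -/
theorem PositiveLinearMap.separableSpace_GNS {A : Type*} [CStarAlgebra A] [PartialOrder A]
    [StarOrderedRing A] [TopologicalSpace.SeparableSpace A] (f : A →ₚ[ℂ] ℂ) :
    TopologicalSpace.SeparableSpace f.GNS := by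
  obtain ⟨C, hC⟩ := f.exists_norm_apply_le
  have hcont : Continuous f.toPreGNS := by
    refine AddMonoidHomClass.continuous_of_bound (f.toPreGNS.toLinearMap) √C fun x => ?_
    change ‖f.toPreGNS x‖ ≤ √(C : ℝ) * ‖x‖
    rw [f.preGNS_norm_def]
    refine Real.sqrt_le_iff.mpr ⟨by positivity, ?_⟩
    rw [mul_pow, Real.sq_sqrt (NNReal.coe_nonneg C), sq ‖x‖, ← CStarRing.norm_star_mul_self]
    exact (Complex.re_le_norm _).trans (hC _)
  have : DenseRange fun x : A => ((f.toPreGNS x : f.PreGNS) : f.GNS) :=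
    UniformSpace.Completion.denseRange_coe.comp f.toPreGNS.surjective.denseRange
      (UniformSpace.Completion.continuous_coe _)
  exact this.separableSpace ((UniformSpace.Completion.continuous_coe _).comp hcont)

theorem HasCommonNormProperty.not_frontier_subset_derivedSet {T : H →L[ℂ] H}
    (hT : HasCommonNormProperty T) {G : Set ℂ} (hGo : IsOpen G) (hG : Bornology.IsBounded G)
    (hne : G.Nonempty) : ¬ frontier G ⊆ derivedSet (spectrum ℂ T) := by
  intro hsub
  have : IsStarNormal T := hT.isStarNormal
  obtain ⟨a, ha⟩ := hne
  have hcomp : IsCompact (frontier G) := Metric.isCompact_of_isClosed_isBounded isClosed_frontier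
    (hG.closure.subset frontier_subset_closure)
  have : CompactSpace (frontier G) := isCompact_iff_compactSpace.mp hcomp
  obtain ⟨f, hf⟩ := exists_state_frontier_eval hG ha
  let Φ := Polynomial.toContinuousMapOnAlgHom (R := ℂ) (frontier G)
  let z : C(frontier G, ℂ) := Φ Polynomial.X
  have hz : ∀ s : frontier G, z s = s := fun s => Polynomial.eval_X
  have := f.separableSpace_GNS
  let A := f.gnsStarAlgHom z
  have hA : ∀ ε : ℝ, 0 < ε → ∃ W : f.GNS →ₗᵢ[ℂ] H, ∀ g, ‖T (W g) - W (A g)‖ ≤ ε * ‖g‖ := by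
    intro ε hε
    obtain ⟨t, u, hu, huz⟩ := z.exists_quadratic_partition_of_unity (half_pos hε)
    obtain ⟨W, hW⟩ := exists_isometry_norm_comp_sub_comp_le (T := T) (μ := fun i : t => z i)
      (fun i => by rw [hz]; exact hsub i.1.2) f.gnsStarAlgHom hu (half_pos hε) huz
    exact ⟨W, fun g => (hW g).trans_eq (by ring)⟩
  let emb : C(frontier G, ℂ) →ₗ[ℂ] f.GNS :=
    (UniformSpace.Completion.toComplL (𝕜 := ℂ) (E := f.PreGNS)).toLinearMap ∘ₗ
      f.toPreGNS.toLinearMap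
  have hemb : ∀ c d, ⟪emb c, emb d⟫_ℂ = f (star c * d) := fun c d => by
    exact (UniformSpace.Completion.inner_coe _ _).trans (f.preGNS_inner_def _ _)
  have hAemb : ∀ c, A (emb c) = emb (z * c) := fun c =>
    f.gnsNonUnitalStarAlgHom_apply_coe
  let q : Polynomial ℂ := Polynomial.X - Polynomial.C a
  let L : Polynomial ℂ →ₗ[ℂ] f.GNS := emb ∘ₗ Φ.toLinearMap ∘ₗ LinearMap.mulLeft ℂ q
  have hL : ∀ p, L p = emb (Φ (q * p)) := fun _ => rfl
  let E := (LinearMap.range L).topologicalClosure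
  have : CompleteSpace E := (Submodule.isClosed_topologicalClosure _).completeSpace_coe
  have hLE : ∀ p, L p ∈ E := fun p => Submodule.le_topologicalClosure _ ⟨p, rfl⟩
  have hinv : ∀ g ∈ E, A g ∈ E := by
    intro g hg
    refine map_mem_closure A.continuous hg ?_
    rintro _ ⟨p, rfl⟩
    refine ⟨Polynomial.X * p, ?_⟩
    rw [hL, hL, hAemb, ← map_mul]
    congr 2
    ring
  have hξ : emb 1 ∈ Eᗮ := by
    rw [Submodule.orthogonal_closure]
    rintro _ ⟨p, rfl⟩
    rw [inner_eq_zero_symm, hL, hemb, star_one, one_mul, hf]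
    simp [q]
  have hred := hT.mul_mul_one_sub_eq_zero_of_approximate_part hA
    (isStarProjection_starProjection (U := E)) (by
      ext g
      have := Submodule.starProjection_eq_self_iff.mpr (hinv _ (E.starProjection_apply_mem g))
      simp [this])
  have hAξ : A (emb 1) = a • emb 1 + L 1 := by
    rw [hAemb, hL, ← map_smul, ← map_add]
    congr 1
    ext s
    simp [q, z, Φ]
  have hPξ : E.starProjection (emb 1) = 0 := (Submodule.starProjection_apply_eq_zero_iff _).mpr hξ
  -- Since `A 1 = a • 1 + (z - a)` with `1 ⊥ E` and `z - a ∈ E`, the vanishing corner applied to `1`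
  -- leaves exactly `z - a`.
  have hL1 : L 1 = 0 := by
    have h := DFunLike.congr_fun hred (emb 1)
    simp only [mul_apply_eq_comp, sub_apply, one_apply_eq_self, hPξ, sub_zero, hAξ, map_add,
      map_smul, smul_zero, zero_add, zero_apply] at h
    rwa [Submodule.starProjection_eq_self_iff.mpr (hLE 1)] at h
  obtain ⟨d, hd, hball⟩ := Metric.isOpen_iff.mp hGo a ha
  have hle : ((d ^ 2 : ℝ) : ℂ) • (1 : C(frontier G, ℂ)) ≤ star (Φ q) * Φ q := by
    refine ContinuousMap.le_def.mpr fun s => ?_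
    have hs : d ≤ ‖(s : ℂ) - a‖ := by
      by_contra! hlt
      have h2 : (s : ℂ) ∈ G := hball (by simpa [dist_eq_norm] using hlt)
      exact hGo.inter_frontier_eq.subset ⟨h2, s.2⟩
    have : (star (Φ q) * Φ q) s = ((‖(s : ℂ) - a‖ ^ 2 : ℝ) : ℂ) := by
      simp only [ContinuousMap.mul_apply, ContinuousMap.star_apply, Complex.star_def,
        Complex.conj_mul']
      simp [Φ, q]
    rw [this]
    simp only [ContinuousMap.smul_apply, ContinuousMap.one_apply, smul_eq_mul, mul_one]
    exact_mod_cast pow_le_pow_left₀ hd.le hs 2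
  have hmono := OrderHomClass.mono f hle
  have h1 : f 1 = 1 := by
    have h := hf 1
    rwa [map_one, Polynomial.eval_one] at h
  have h0 : f (star (Φ q) * Φ q) = 0 := by
    have := hemb (Φ (q * 1)) (Φ (q * 1))
    rw [← hL, hL1, inner_zero_left, mul_one] at this
    exact this.symm
  rw [map_smul, h1, h0, smul_eq_mul, mul_one] at hmono
  have : d ^ 2 ≤ 0 := by exact_mod_cast hmono
  nlinarith

end States

/-! ### Plane topology: producing `G` from a non-Lavrentiev compact set. -/

section Topology
open Set Metric Filter Topology Bornology

theorem Complex.isPreconnected_ball_diff_center (c : ℂ) {r : ℝ} (hr : 0 < r) :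
    IsPreconnected (ball c r \ {c}) := by
  have : ball c r \ {c} = (fun w => c + Complex.exp w) '' {w | w.re < Real.log r} := by
    ext z
    simp only [Set.mem_sdiff, mem_ball, dist_eq_norm, mem_singleton_iff, mem_image, mem_ofPred_eq]
    constructor
    · rintro ⟨h1, h2⟩
      have h3 : z - c ≠ 0 := sub_ne_zero.mpr h2
      exact ⟨Complex.log (z - c), by
        rw [Complex.log_re]; exact Real.log_lt_log (norm_pos_iff.mpr h3) h1, by
        rw [Complex.exp_log h3]; ring⟩
    · rintro ⟨w, hw, rfl⟩
      refine ⟨?_, by simp⟩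
      rw [add_sub_cancel_left, Complex.norm_exp]
      exact (Real.lt_log_iff_exp_lt hr).mp hw
  rw [this]
  exact (convex_halfSpace_re_lt _).isPreconnected.image _ (by fun_prop)

theorem Complex.isPreconnected_compl_closedBall (c : ℂ) {r : ℝ} (hr : 0 < r) :
    IsPreconnected (closedBall c r)ᶜ := by
  have : (closedBall c r)ᶜ = (fun w => c + Complex.exp w) '' {w | Real.log r < w.re} := by
    ext z
    simp only [mem_compl_iff, mem_closedBall, dist_eq_norm, not_le, mem_image, mem_ofPred_eq]
    constructor
    · intro h1
      have h3 : z - c ≠ 0 := norm_pos_iff.mp (hr.trans h1)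
      exact ⟨Complex.log (z - c), by
        rw [Complex.log_re]; exact Real.log_lt_log hr h1, by
        rw [Complex.exp_log h3]; ring⟩
    · rintro ⟨w, hw, rfl⟩
      rw [add_sub_cancel_left, Complex.norm_exp]
      exact (Real.log_lt_iff_lt_exp hr).mp hw
  rw [this]
  exact (convex_halfSpace_re_gt _).isPreconnected.image _ (by fun_prop)

theorem accPt_of_mem_interior {S : Set ℂ} {z : ℂ} (hz : z ∈ interior S) : z ∈ derivedSet S := by
  rw [mem_derivedSet, accPt_iff_frequently_nhdsNE]
  exact Filter.Eventually.frequently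
    (mem_nhdsWithin_of_mem_nhds (mem_interior_iff_mem_nhds.mp hz))

theorem exists_isOpen_frontier_subset_derivedSet_of_interior_nonempty {S : Set ℂ}
    (hS : (interior S).Nonempty) :
    ∃ G : Set ℂ, IsOpen G ∧ IsBounded G ∧ G.Nonempty ∧ frontier G ⊆ derivedSet S := by
  obtain ⟨z, hz⟩ := hS
  obtain ⟨r, hr, hball⟩ := nhds_basis_closedBall.mem_iff.mp (isOpen_interior.mem_nhds hz)
  exact ⟨ball z r, isOpen_ball, isBounded_ball, ⟨z, mem_ball_self hr⟩, fun w hw =>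
    accPt_of_mem_interior (hball (closure_ball_subset_closedBall (frontier_subset_closure hw)))⟩

/-- A bounded clopen part `U` of the complement of `S` gives, after adding isolated points of `S`,
a bounded open set whose frontier consists of accumulation points of `S`. -/
theorem exists_isOpen_frontier_subset_derivedSet_of_bounded_piece {S U V : Set ℂ}
    (hU : IsOpen U) (hV : IsOpen V) (hUV : Disjoint U V) (hcov : Sᶜ ⊆ U ∪ V) (hne : U.Nonempty)
    (hbdd : IsBounded U) :
    ∃ G : Set ℂ, IsOpen G ∧ IsBounded G ∧ G.Nonempty ∧ frontier G ⊆ derivedSet S := by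
  have hVc : Disjoint (closure U) V := hUV.closure_left hV
  -- An added point has a punctured disc missing `S`; this is connected and meets `U`, so it lies in
  -- `U`. Hence `G` is open.
  let G := U ∪ closure U \ derivedSet S
  have hGcl : G ⊆ closure U := union_subset subset_closure sdiff_subset
  have hGo : IsOpen G := by
    rw [isOpen_iff_mem_nhds]
    intro z hz
    by_cases hzU : z ∈ U
    · exact mem_of_superset (hU.mem_nhds hzU) subset_union_left
    obtain ⟨hzc, hzd⟩ := hz.resolve_left hzU
    rw [mem_derivedSet, accPt_iff_nhds] at hzd
    push Not at hzd
    obtain ⟨N, hN, hNS⟩ := hzd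
    obtain ⟨r, hr, hrN⟩ := Metric.mem_nhds_iff.mp hN
    have hsub : ball z r \ {z} ⊆ U ∪ V := fun w hw => hcov fun hwS =>
      hw.2 (hNS w ⟨hrN hw.1, hwS⟩)
    have hsubU : ball z r \ {z} ⊆ U := by
      refine (Complex.isPreconnected_ball_diff_center z hr).subset_left_of_subset_union hU hV hUV
        hsub ?_
      obtain ⟨w, hw, hwU⟩ := mem_closure_iff.mp hzc _ isOpen_ball (mem_ball_self hr)
      exact ⟨w, ⟨hw, fun h => hzU (mem_singleton_iff.mp h ▸ hwU)⟩, hwU⟩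
    refine mem_of_superset (ball_mem_nhds z hr) fun w hw => ?_
    by_cases hwz : w = z
    · exact hwz ▸ hz
    · exact Or.inl (hsubU ⟨hw, hwz⟩)
  refine ⟨G, hGo, hbdd.closure.subset hGcl, hne.mono subset_union_left, fun z hz => ?_⟩
  have hzc : z ∈ closure U := closure_minimal hGcl isClosed_closure hz.1
  have hzG : z ∉ G := fun h => hGo.inter_frontier_eq.subset ⟨h, hz⟩
  by_contra hzd
  exact hzG (Or.inr ⟨hzc, hzd⟩)

/-- The exterior of a large disc is connected, so it falls in one piece of any separation; the other
piece is bounded, and yields a forbidden `G` unless empty. -/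
theorem isConnected_compl_of_forall_not_frontier_subset_derivedSet {S : Set ℂ} (hS : IsCompact S)
    (h : ∀ G : Set ℂ, IsOpen G → IsBounded G → G.Nonempty → ¬ frontier G ⊆ derivedSet S) :
    IsConnected Sᶜ := by
  obtain ⟨r, hr, hSr⟩ := hS.isBounded.subset_closedBall_lt 0 0
  have hext : (closedBall (0 : ℂ) r)ᶜ ⊆ Sᶜ := compl_subset_compl.mpr hSr
  have hextp := Complex.isPreconnected_compl_closedBall 0 hr
  have hextne : (closedBall (0 : ℂ) r)ᶜ.Nonempty := by
    by_contra hne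
    rw [not_nonempty_iff_eq_empty, compl_empty_iff] at hne
    exact NormedSpace.unbounded_univ ℂ ℂ (hne ▸ isBounded_closedBall)
  refine ⟨hextne.mono hext, ?_⟩
  have key : ∀ U V : Set ℂ, IsOpen U → IsOpen V → Disjoint U V → Sᶜ ⊆ U ∪ V →
      (closedBall (0 : ℂ) r)ᶜ ⊆ V → U.Nonempty → False := by
    intro U V hU hV hUV hcov hball hne
    have hbdd : IsBounded U := isBounded_closedBall.subset
      (fun z hz => by_contra fun hzb => hUV.le_bot ⟨hz, hball hzb⟩)
    obtain ⟨G, h1, h2, h3, h4⟩ :=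
      exists_isOpen_frontier_subset_derivedSet_of_bounded_piece hU hV hUV hcov hne hbdd
    exact h G h1 h2 h3 h4
  have hSo : IsOpen Sᶜ := hS.isClosed.isOpen_compl
  rw [isPreconnected_iff_subset_of_disjoint]
  intro U V hU hV hcov hdisj
  have hd : Disjoint (Sᶜ ∩ U) (Sᶜ ∩ V) := by
    rw [Set.disjoint_iff_inter_eq_empty, ← inter_inter_distrib_left, hdisj]
  have hcov' : Sᶜ ⊆ (Sᶜ ∩ U) ∪ (Sᶜ ∩ V) := by
    rw [← inter_union_distrib_left]; exact subset_inter subset_rfl hcov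
  have hpiece : ∀ A B : Set ℂ, Sᶜ ⊆ (Sᶜ ∩ A) ∪ (Sᶜ ∩ B) → ¬ (Sᶜ ∩ A).Nonempty → Sᶜ ⊆ B := by
    intro A B hAB hA z hz
    rcases hAB hz with h | h
    · exact absurd ⟨z, h⟩ hA
    · exact h.2
  rcases isPreconnected_iff_subset_of_disjoint.mp hextp _ _ (hSo.inter hU) (hSo.inter hV)
      (hext.trans hcov') (by rw [hd.inter_eq, inter_empty]) with hb | hb
  · exact Or.inl (hpiece V U (by rwa [union_comm])
      (key _ _ (hSo.inter hV) (hSo.inter hU) hd.symm (by rwa [union_comm]) hb))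
  · exact Or.inr (hpiece U V hcov' (key _ _ (hSo.inter hU) (hSo.inter hV) hd hcov' hb))

end Topology

theorem proposition4p02 {H : Type*} [NormedAddCommGroup H] [InnerProductSpace ℂ H]
    [CompleteSpace H] [TopologicalSpace.SeparableSpace H] (hH : ¬ FiniteDimensional ℂ H)
    (T : H →L[ℂ] H) (hT : HasCommonNormProperty T) :
    IsStarNormal T ∧ IsLavrentiev (spectrum ℂ T) := by
  refine ⟨hT.isStarNormal, spectrum.isCompact T, ?_, ?_⟩
  · by_contra hne
    obtain ⟨G, h1, h2, h3, h4⟩ := exists_isOpen_frontier_subset_derivedSet_of_interior_nonempty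
      (Set.nonempty_iff_ne_empty.mpr hne)
    exact hT.not_frontier_subset_derivedSet h1 h2 h3 h4
  · exact isConnected_compl_of_forall_not_frontier_subset_derivedSet (spectrum.isCompact T)
      fun G h1 h2 h3 => hT.not_frontier_subset_derivedSet h1 h2 h3
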